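/- Setting. There are $M$ contexts and, for each context $m\in[M]$, a known finite action set $\mathcal A^m\subset\mathbb R^d$ with $|\mathcal A^m|=K$, spanning $\mathbb R^d$ and contained in the Euclidean unit ball. For a context distribution $p$ on $[M]$ and a parameter $\theta\in\mathbb R^d$, the game with horizon $n$ runs as follows: in round $t=1,\dots,n$ a context $c_t\sim p$ is drawn independently of the past and revealed; the policy $\pi$ chooses (possibly at random) an action $X_t\in\mathcal A^{c_t}$ based on the past contexts, actions and rewards and on $c_t$ (it may use $n$ and the action sets, but knows neither $p$ nor $\theta$); it then receives $Y_t=\langle X_t,\theta\rangle+\eta_t$, where the $\eta_t$ are independent standard Gaussian variables. The expected regret is $$R_\theta^\pi(n)=\mathbb E\Big[\sum_{t=1}^n\max_{x\in\mathcal A^{c_t}}\langle x,\theta\rangle-\sum_{t=1}^nY_t\Big].$$ The policy $\pi$ is consistent if $R_\theta^\pi(n)=o(n^\varepsilon)$ as $n\to\infty$ for all $\varepsilon>0$, all $\theta\in\mathbb R^d$ and all context distributions giving positive probability to every context. Lemma. Let $\pi$ be consistent. Fix a context distribution $p$ with $p(m)>0$ for all $m\in[M]$ and a $\theta\in\mathbb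 R^d$ such that for each context $m$ the optimal arm $x_m^*=\arg\max_{x\in\mathcal A^m}\langle x,\theta\rangle$ is unique. Then for all sufficiently large $n$ the matrix $\bar G_n=\mathbb E\big[\sum_{t=1}^nX_tX_t^\top\big]$ (expectation for $\pi$, $p$, $\theta$ and horizon $n$) is invertible, and for every context $m$ and every arm $x\in\mathcal A^m$, $$\limsup_{n\to\infty}\ \log(n)\,\|x-x_m^*\|^2_{\bar G_n^{-1}}\le\frac{(\Delta_x^m)^2}{2},$$ where $\Delta_x^m=\langle x_m^*-x,\theta\rangle$ and $\|v\|_A=\sqrt{v^\top Av}$. -/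

import Mathlib

open MeasureTheory ProbabilityTheory Filter Topology
open scoped Matrix RealInnerProductSpace

noncomputable section

namespace ContextualBandit

/-- What is recorded in one round: the context `c_t`, the (index of the) arm chosen in the
action set of that context, and the reward `Y_t`. -/
abbrev Round (M K : ℕ) : Type := (Fin M × Fin K) × ℝ

/-- The history of the first `t` rounds. -/
abbrev History (M K t : ℕ) : Type := Fin t → Round M K

/-- A (possibly randomised) policy for `M` contexts with `K` arms each. When the game is played
with horizon `n`, then after `t` completed rounds the policy sees the history of these rounds and
the current context, and draws an arm from `select n t (history, context)`. The policy may use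
the horizon `n`; an anytime policy is one for which `select n t` does not depend on `n`.
It has no access to the parameter or to the context distribution. -/
structure Policy (M K : ℕ) where
  select : (n t : ℕ) → Kernel (History M K t × Fin M) (Fin K)
  markov : ∀ n t, IsMarkovKernel (select n t)

attribute [instance] Policy.markov

variable {d M K : ℕ}

/-- The reward given context `m` and arm `k` is `⟨x, θ⟩ + η` with `x = arm m k` and `η` a
standard Gaussian, i.e. it has law `N(⟨x, θ⟩, 1)`. -/
def rewardKernel (arm : Fin M → Fin K → EuclideanSpace ℝ (Fin d))
    (θ : EuclideanSpace ℝ (Fin d)) : Kernel (Fin M × Fin K) ℝ :=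
  Kernel.ofFunOfCountable fun a => gaussianReal ⟪arm a.1 a.2, θ⟫ 1

instance (arm : Fin M → Fin K → EuclideanSpace ℝ (Fin d)) (θ : EuclideanSpace ℝ (Fin d)) :
    IsMarkovKernel (rewardKernel arm θ) :=
  ⟨fun a => inferInstanceAs (IsProbabilityMeasure (gaussianReal ⟪arm a.1 a.2, θ⟫ 1))⟩

/-- The law of round `t + 1` given the history of the first `t` rounds (horizon `n`): a context
drawn from `p` independently of the past, then an arm drawn by the policy, then the reward. -/
def roundKernel (arm : Fin M → Fin K → EuclideanSpace ℝ (Fin d)) (p : PMF (Fin M))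
    (θ : EuclideanSpace ℝ (Fin d)) (π : Policy M K) (n t : ℕ) :
    Kernel (History M K t) (Round M K) :=
  ((Kernel.const (History M K t) p.toMeasure) ⊗ₖ (π.select n t)) ⊗ₖ
    ((rewardKernel arm θ).prodMkLeft (History M K t))

instance (arm : Fin M → Fin K → EuclideanSpace ℝ (Fin d)) (p : PMF (Fin M))
    (θ : EuclideanSpace ℝ (Fin d)) (π : Policy M K) (n t : ℕ) :
    IsMarkovKernel (roundKernel arm p θ π n t) := by
  unfold roundKernel; infer_instance

/-- The law of the history of the first `t` rounds when policy `π` plays, with horizon `n`, the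
bandit with action sets `arm`, context distribution `p` and parameter `θ`. -/
def historyLaw (arm : Fin M → Fin K → EuclideanSpace ℝ (Fin d)) (p : PMF (Fin M))
    (θ : EuclideanSpace ℝ (Fin d)) (π : Policy M K) (n : ℕ) :
    (t : ℕ) → Measure (History M K t)
  | 0 => Measure.dirac Fin.elim0
  | t + 1 => ((historyLaw arm p θ π n t) ⊗ₘ (roundKernel arm p θ π n t)).map
      fun hr => (Fin.snoc hr.1 hr.2 : History M K (t + 1))

lemma measurable_snoc (t : ℕ) : Measurable
    (fun hr : History M K t × Round M K => (Fin.snoc hr.1 hr.2 : History M K (t + 1))) := by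
  refine measurable_pi_iff.2 fun i => ?_
  induction i using Fin.lastCases with
  | last => simpa using measurable_snd
  | cast i =>
    simp only [Fin.snoc_castSucc]
    exact (measurable_pi_apply i).comp measurable_fst

instance (arm : Fin M → Fin K → EuclideanSpace ℝ (Fin d)) (p : PMF (Fin M))
    (θ : EuclideanSpace ℝ (Fin d)) (π : Policy M K) (n t : ℕ) :
    IsProbabilityMeasure (historyLaw arm p θ π n t) := by
  induction t with
  | zero => unfold historyLaw; infer_instance
  | succ t ih =>
    unfold historyLaw
    exact Measure.isProbabilityMeasure_map (measurable_snoc t).aemeasurable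

/-- The context `c_t` of a round of the history. -/
def contextAt {n : ℕ} (h : History M K n) (t : Fin n) : Fin M := (h t).1.1

/-- The action `X_t`, a vector of `ℝ^d`. -/
def actionAt (arm : Fin M → Fin K → EuclideanSpace ℝ (Fin d)) {n : ℕ} (h : History M K n)
    (t : Fin n) : EuclideanSpace ℝ (Fin d) := arm (h t).1.1 (h t).1.2

/-- The reward `Y_t`. -/
def rewardAt {n : ℕ} (h : History M K n) (t : Fin n) : ℝ := (h t).2

/-- The expected cumulative regret
`R_θ^π(n) = E[∑_{t ≤ n} max_{x ∈ A^{c_t}} ⟨x, θ⟩ - ∑_{t ≤ n} Y_t]`. -/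
def regret (arm : Fin M → Fin K → EuclideanSpace ℝ (Fin d)) (p : PMF (Fin M))
    (θ : EuclideanSpace ℝ (Fin d)) (π : Policy M K) (n : ℕ) : ℝ :=
  ∫ h, (∑ t, (⨆ k, ⟪arm (contextAt h t) k, θ⟫) - ∑ t, rewardAt h t)
    ∂(historyLaw arm p θ π n n)

/-- `π` is consistent (for the given action sets): the regret is `o(n^ε)` for every `ε > 0`,
every parameter, and every context distribution giving positive probability to each context. -/
def IsConsistent (arm : Fin M → Fin K → EuclideanSpace ℝ (Fin d)) (π : Policy M K) : Prop :=
  ∀ p : PMF (Fin M), (∀ m, 0 < p m) → ∀ θ : EuclideanSpace ℝ (Fin d), ∀ ε : ℝ, 0 < ε →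
    (fun n : ℕ => regret arm p θ π n) =o[atTop] (fun n : ℕ => (n : ℝ) ^ ε)

/-- The `k`-th arm is optimal in context `m`: it maximises `⟨x, θ⟩` over the action set. -/
def IsOptimalArm (arm : Fin M → Fin K → EuclideanSpace ℝ (Fin d))
    (θ : EuclideanSpace ℝ (Fin d)) (m : Fin M) (k : Fin K) : Prop :=
  ∀ j, ⟪arm m j, θ⟫ ≤ ⟪arm m k, θ⟫

/-- The expected design matrix `E[∑_{t ≤ n} X_t X_tᵀ]` (entrywise expectation). -/
def expectedDesign (arm : Fin M → Fin K → EuclideanSpace ℝ (Fin d)) (p : PMF (Fin M))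
    (θ : EuclideanSpace ℝ (Fin d)) (π : Policy M K) (n : ℕ) : Matrix (Fin d) (Fin d) ℝ :=
  Matrix.of fun i j => ∫ h,
    (∑ t, Matrix.vecMulVec (actionAt arm h t).ofLp (actionAt arm h t).ofLp) i j
      ∂(historyLaw arm p θ π n n)

/-- The weighted norm `‖x‖_A = √(xᵀ A x)`. -/
def weightedNorm (A : Matrix (Fin d) (Fin d) ℝ) (x : EuclideanSpace ℝ (Fin d)) : ℝ :=
  √(x.ofLp ⬝ᵥ (A *ᵥ x.ofLp))

end ContextualBandit

end

/-!
Write `G n` for the expected design matrix at horizon `n`. It equals `∑ a, w n a • a aᵀ`, where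
`w n a` is the expected number of plays of the arm `a` (`expectedPulls`), so that its quadratic form
is `designForm n v = ∑ a, w n a * ⟪a, v⟫ ^ 2`.

*Change of measure.* Let `v` be such that the optimal arm `k₀` of some context `m` is not optimal for
`θ + v`. The laws of the history for `θ` and `θ + v` have relative entropy `designForm n v / 2`
(`historyLaw_add`, `integral_sum_logRatio`). Consistency at `θ` makes `k₀` the usual choice in context
`m`, consistency at `θ + v` makes it a rare one, both up to `n ^ ε` plays. A Bretagnolle–Huber type
inequality turns this into `exp (-designForm n v / 2 - 1) ≤ C * n ^ (ε - 1)`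
(`exp_neg_designForm_le`), hence `designForm n v ≥ c * log n` eventually, for every `c < 2`
(`eventually_mul_log_le_designForm`).

*From single directions to the matrix.* By duality `1 / ‖y‖²_{G⁻¹}` is the minimum of `vᵀ G v` over
`⟪y, v⟫ = 1`, and for `y = x - x*` each such `v`, scaled by slightly more than the gap `Δ`, is a
direction as above. The lower bound holds for each fixed `v`, whereas the minimiser depends on `n`.
The form is a nonnegative combination of the squares of finitely many fixed linear functionals, and
for such forms `exists_frequently_sum_sq_le` replaces the minimisers by one fixed direction.
Invertibility follows in the same way: for each of the finitely many possible supports of the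
weights `w n`, a common null direction would contradict `eventually_designForm_pos`.
-/

noncomputable section

/-! ### Compactness for sums of squares -/

/-- A compactness principle for sums of squares `Q n v = ∑ i, w n i * ⟪a i, v⟫ ^ 2` with fixed
vectors `a i` and arbitrary nonnegative weights: if on the hyperplane `⟪y, v⟫ = 1` the form `Q n` is
frequently small at a point depending on `n`, then it is frequently almost as small at a fixed
point. For general quadratic forms this fails, since their null directions may rotate. -/
lemma exists_frequently_sum_sq_le {ι E : Type*} [Fintype ι] [NormedAddCommGroup E]
    [InnerProductSpace ℝ E] [FiniteDimensional ℝ E] (a : ι → E) (y : E) (w : ℕ → ι → ℝ)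
    (hw : ∀ n i, 0 ≤ w n i) {b b' : ℝ} (hb : b < b')
    (h : ∃ᶠ n in atTop, ∃ v, ⟪y, v⟫ = 1 ∧ ∑ i, w n i * ⟪a i, v⟫ ^ 2 ≤ b) :
    ∃ v, ⟪y, v⟫ = 1 ∧ ∃ᶠ n in atTop, ∑ i, w n i * ⟪a i, v⟫ ^ 2 ≤ b' := by
  classical
  obtain ⟨U, hU, hUs⟩ : ∃ U : Ultrafilter ℕ, (U : Filter ℕ) ≤ atTop ∧
      ∀ᶠ n in (U : Filter ℕ), ∃ v, ⟪y, v⟫ = 1 ∧ ∑ i, w n i * ⟪a i, v⟫ ^ 2 ≤ b := by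
    set s := {n : ℕ | ∃ v : E, ⟪y, v⟫ = 1 ∧ ∑ i, w n i * ⟪a i, v⟫ ^ 2 ≤ b}
    have : NeBot (atTop ⊓ 𝓟 s) := frequently_mem_iff_neBot.1 h
    exact ⟨Ultrafilter.of (atTop ⊓ 𝓟 s), (Ultrafilter.of_le _).trans inf_le_left,
      ((Ultrafilter.of_le _).trans inf_le_right) (mem_principal_self s)⟩
  obtain ⟨v, hv⟩ : ∃ v : ℕ → E, ∀ᶠ n in (U : Filter ℕ),
      ⟪y, v n⟫ = 1 ∧ ∑ i, w n i * ⟪a i, v n⟫ ^ 2 ≤ b := hUs.choice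
  have hterm : ∀ᶠ n in (U : Filter ℕ), ∀ i, w n i * ⟪a i, v n⟫ ^ 2 ≤ b := by
    filter_upwards [hv] with n hn i
    exact (Finset.single_le_sum (f := fun i => w n i * ⟪a i, v n⟫ ^ 2)
      (fun i _ => mul_nonneg (hw n i) (sq_nonneg _)) (Finset.mem_univ i)).trans hn.2
  -- the weights converge in `[0, ∞]` along the ultrafilter
  have hlim : ∀ i, ∃ W : ENNReal,
      Tendsto (fun n => ENNReal.ofReal (w n i)) (U : Filter ℕ) (𝓝 W) := fun i => by
    obtain ⟨W, -, hW⟩ := isCompact_univ.ultrafilter_le_nhds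
      (U.map fun n => ENNReal.ofReal (w n i)) (by simp)
    exact ⟨W, hW⟩
  choose W hW using hlim
  -- where the weight tends to `0` the values `⟪a i, v n⟫` may be unbounded, and are dropped
  let T : E →ₗ[ℝ] (ι → ℝ) × ℝ :=
    (LinearMap.pi fun i => if W i = 0 then 0 else (innerₗ E (a i))).prod (innerₗ E y)
  have hT : ∀ u, T u = (fun i => if W i = 0 then 0 else ⟪a i, u⟫, ⟪y, u⟫) := by
    intro u
    refine Prod.ext (funext fun i => ?_) rfl
    by_cases h0 : W i = 0 <;> simp [T, h0]
  have hz : ∀ i, ∃ z, Tendsto (fun n => (T (v n)).1 i) (U : Filter ℕ) (𝓝 z) := by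
    intro i
    by_cases h0 : W i = 0
    · exact ⟨0, by simp [hT, h0]⟩
    obtain ⟨ε, hε0, hε⟩ := ENNReal.lt_iff_exists_nnreal_btwn.1 (pos_iff_ne_zero.2 h0)
    have hε0' : (0 : ℝ) < ε := by exact_mod_cast hε0
    have hbd : ∀ᶠ n in (U : Filter ℕ), (T (v n)).1 i ∈ Set.Icc (-√(b / ε)) (√(b / ε)) := by
      filter_upwards [hterm, (hW i).eventually (lt_mem_nhds hε)] with n hn hnε
      rw [ENNReal.lt_ofReal_iff_toReal_lt (by simp)] at hnε
      have h1 : (ε : ℝ) * ⟪a i, v n⟫ ^ 2 ≤ b :=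
        (mul_le_mul_of_nonneg_right hnε.le (sq_nonneg _)).trans (hn i)
      have : |⟪a i, v n⟫| ≤ √(b / ε) := by
        refine Real.abs_le_sqrt ?_
        rw [le_div_iff₀ hε0']; linarith
      simpa [hT, h0] using abs_le.1 this
    obtain ⟨z, -, hz⟩ := isCompact_Icc.ultrafilter_le_nhds
      (U.map fun n => (T (v n)).1 i) (le_principal_iff.2 hbd)
    exact ⟨z, hz⟩
  choose z hz using hz
  -- ranges of linear maps are closed in finite dimension, so the limit `z` of the values
  -- `⟪a i, v n⟫` at non-vanishing weights is again attained on the hyperplane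
  obtain ⟨u, hu⟩ : ((z, 1) : (ι → ℝ) × ℝ) ∈ T.range := by
    refine T.range.closed_of_finiteDimensional.mem_of_tendsto (b := (U : Filter ℕ))
      (f := fun n => T (v n)) ?_ (Eventually.of_forall fun n => ⟨v n, rfl⟩)
    refine (tendsto_pi_nhds.2 hz).prodMk_nhds ?_
    refine tendsto_const_nhds.congr' ?_
    filter_upwards [hv] with n hn
    simp [hn.1]
  rw [hT] at hu
  refine ⟨u, congrArg Prod.snd hu, Frequently.filter_mono ?_ hU⟩
  have hzu : ∀ i, W i ≠ 0 → ⟪a i, u⟫ = z i := fun i hi => by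
    simpa [hi] using congrFun (congrArg Prod.fst hu) i
  have hzv : ∀ i, W i ≠ 0 → Tendsto (fun n => ⟪a i, v n⟫) (U : Filter ℕ) (𝓝 (z i)) :=
    fun i hi => by simpa [hT, hi] using hz i
  have hwreal : ∀ i, W i ≠ ⊤ → Tendsto (fun n => w n i) (U : Filter ℕ) (𝓝 (W i).toReal) :=
    fun i hi => ((ENNReal.tendsto_toReal hi).comp (hW i)).congr fun n => by simp [hw n i]
  have hcmp : ∀ i, ∀ δ > 0, ∀ᶠ n in (U : Filter ℕ),
      w n i * ⟪a i, u⟫ ^ 2 ≤ w n i * ⟪a i, v n⟫ ^ 2 + δ := by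
    intro i δ hδ
    by_cases h0 : W i = 0
    · have : Tendsto (fun n => w n i * ⟪a i, u⟫ ^ 2) (U : Filter ℕ) (𝓝 0) := by
        simpa [h0] using (hwreal i (by simp [h0])).mul_const (⟪a i, u⟫ ^ 2)
      filter_upwards [this.eventually (gt_mem_nhds hδ)] with n hn
      have := mul_nonneg (hw n i) (sq_nonneg ⟪a i, v n⟫)
      linarith
    -- an infinite limit of the weight forces `⟪a i, u⟫ = 0`
    by_cases htop : W i = ⊤
    · have hwtop : Tendsto (fun n => w n i) (U : Filter ℕ) atTop := by
        have := hW i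
        rw [htop] at this
        exact ENNReal.tendsto_ofReal_nhds_top.1 this
      have h2 : Tendsto (fun n => b / w n i) (U : Filter ℕ) (𝓝 0) := hwtop.const_div_atTop b
      have h3 : z i ^ 2 ≤ 0 := by
        refine le_of_tendsto_of_tendsto ((hzv i h0).pow 2) h2 ?_
        filter_upwards [hterm, hwtop.eventually_gt_atTop 0] with n hn hn0
        rw [le_div_iff₀ hn0]; linarith [hn i]
      have h4 : ⟪a i, u⟫ = 0 := by
        rw [hzu i h0]; exact pow_eq_zero_iff two_ne_zero |>.1 (le_antisymm h3 (sq_nonneg _))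
      refine Eventually.of_forall fun n => ?_
      have := mul_nonneg (hw n i) (sq_nonneg ⟪a i, v n⟫)
      rw [h4]; linarith
    · have : Tendsto (fun n => w n i * ⟪a i, u⟫ ^ 2 - w n i * ⟪a i, v n⟫ ^ 2)
          (U : Filter ℕ) (𝓝 0) := by
        have h5 := ((hwreal i htop).mul_const (⟪a i, u⟫ ^ 2)).sub
          ((hwreal i htop).mul ((hzv i h0).pow 2))
        rwa [← hzu i h0, sub_self] at h5
      filter_upwards [this.eventually (gt_mem_nhds hδ)] with n hn
      linarith
  have hδ : 0 < (b' - b) / (Fintype.card ι + 1) := by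
    have := sub_pos.2 hb
    positivity
  have hall := eventually_all.2 fun i => hcmp i _ hδ
  refine Eventually.frequently ?_
  filter_upwards [hall, hv] with n hn hvn
  calc ∑ i, w n i * ⟪a i, u⟫ ^ 2
      ≤ ∑ i, (w n i * ⟪a i, v n⟫ ^ 2 + (b' - b) / (Fintype.card ι + 1)) :=
        Finset.sum_le_sum fun i _ => hn i
    _ = ∑ i, w n i * ⟪a i, v n⟫ ^ 2 +
          Fintype.card ι / (Fintype.card ι + 1) * (b' - b) := by
        rw [Finset.sum_add_distrib]; simp; ring
    _ ≤ b + 1 * (b' - b) := by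
        gcongr
        · exact hvn.2
        · rw [div_le_one (by positivity)]; linarith
    _ = b' := by ring

namespace ContextualBandit

variable {d M K : ℕ}

/-- Changing the mean of a unit-variance Gaussian. -/
lemma lintegral_gaussianReal_add_mean (μ δ : ℝ) {f : ℝ → ENNReal} (hf : Measurable f) :
    ∫⁻ y, f y ∂gaussianReal (μ + δ) 1 =
      ∫⁻ y, f y * ENNReal.ofReal (Real.exp (δ * (y - μ) - δ ^ 2 / 2)) ∂gaussianReal μ 1 := by
  rw [gaussianReal_of_var_ne_zero _ one_ne_zero, gaussianReal_of_var_ne_zero _ one_ne_zero,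
    lintegral_withDensity_eq_lintegral_mul _ (by fun_prop) hf,
    lintegral_withDensity_eq_lintegral_mul _ (by fun_prop) (by fun_prop)]
  refine lintegral_congr fun y => ?_
  simp only [Pi.mul_apply, gaussianPDF, gaussianPDFReal]
  rw [mul_comm (f y), ← mul_assoc, ← ENNReal.ofReal_mul (by positivity)]
  rw [mul_assoc (√_)⁻¹, ← Real.exp_add]
  congr 4
  push_cast
  ring

/-! ### The law of the history -/

section

variable (arm : Fin M → Fin K → EuclideanSpace ℝ (Fin d)) (p : PMF (Fin M))
  (θ : EuclideanSpace ℝ (Fin d)) (π : Policy M K)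

lemma lintegral_roundKernel (n t : ℕ) (h : History M K t) {f : Round M K → ENNReal}
    (hf : Measurable f) :
    ∫⁻ r, f r ∂roundKernel arm p θ π n t h =
      ∫⁻ c, ∫⁻ k, ∫⁻ y, f ((c, k), y) ∂gaussianReal ⟪arm c k, θ⟫ 1
        ∂π.select n t (h, c) ∂p.toMeasure := by
  unfold roundKernel
  rw [Kernel.lintegral_compProd _ _ _ hf, Kernel.lintegral_compProd]
  · rfl
  · exact Measurable.lintegral_kernel_prod_right' (κ := rewardKernel arm θ)
      (f := fun x : (Fin M × Fin K) × ℝ => f x) hf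

lemma lintegral_historyLaw_succ (n t : ℕ) {f : History M K (t + 1) → ENNReal}
    (hf : Measurable f) :
    ∫⁻ h, f h ∂historyLaw arm p θ π n (t + 1) =
      ∫⁻ h, ∫⁻ r, f (Fin.snoc h r) ∂roundKernel arm p θ π n t h ∂historyLaw arm p θ π n t := by
  rw [historyLaw, lintegral_map hf (measurable_snoc t),
    Measure.lintegral_compProd (f := fun hr : History M K t × Round M K =>
      f (Fin.snoc hr.1 hr.2)) (hf.comp (measurable_snoc t))]

/-- Contexts are i.i.d. with law `p`, whatever the policy. -/
lemma lintegral_prod_contextAt (n t : ℕ) (g : Fin M → ENNReal) :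
    ∫⁻ h, ∏ i, g (contextAt h i) ∂historyLaw arm p θ π n t = (∫⁻ c, g c ∂p.toMeasure) ^ t := by
  have hg : Measurable g := measurable_of_finite g
  induction t with
  | zero => simp
  | succ t ih =>
    have hm : ∀ s, Measurable fun h : History M K s => ∏ i, g (contextAt h i) := fun s =>
      Finset.measurable_prod _ fun i _ => hg.comp (measurable_pi_apply i).fst.fst
    rw [lintegral_historyLaw_succ _ _ _ _ _ _ (hm _)]
    have : ∀ h : History M K t, ∫⁻ r, ∏ i, g (contextAt (Fin.snoc h r : History M K (t + 1)) i)
        ∂roundKernel arm p θ π n t h = (∏ i, g (contextAt h i)) * ∫⁻ c, g c ∂p.toMeasure := by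
      intro h
      simp only [contextAt, Fin.prod_univ_castSucc, Fin.snoc_castSucc, Fin.snoc_last]
      have hg' : Measurable fun r : Round M K => g r.1.1 := hg.comp measurable_fst.fst
      rw [lintegral_const_mul _ hg', lintegral_roundKernel _ _ _ _ _ _ _ hg']
      simp
    simp_rw [this]
    rw [lintegral_mul_const _ (hm t), ih, pow_succ]

/-- The log-likelihood ratio, contributed by one round, of the parameter `θ + v` against `θ`. -/
def logRatio (v : EuclideanSpace ℝ (Fin d)) (r : Round M K) : ℝ :=
  ⟪arm r.1.1 r.1.2, v⟫ * (r.2 - ⟪arm r.1.1 r.1.2, θ⟫) - ⟪arm r.1.1 r.1.2, v⟫ ^ 2 / 2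

lemma measurable_comp_arm (f : Fin M × Fin K → ℝ) : Measurable fun r : Round M K => f r.1 :=
  (measurable_of_finite f).comp measurable_fst

lemma measurable_logRatio (v : EuclideanSpace ℝ (Fin d)) :
    Measurable (logRatio arm θ v : Round M K → ℝ) := by
  have h1 := measurable_comp_arm (fun a : Fin M × Fin K => ⟪arm a.1 a.2, v⟫)
  have h2 := measurable_comp_arm (fun a : Fin M × Fin K => ⟪arm a.1 a.2, θ⟫)
  exact (h1.mul (measurable_snd.sub h2)).sub ((h1.pow_const 2).div_const 2)

lemma measurable_sum_round {t : ℕ} {g : Round M K → ℝ} (hg : Measurable g) :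
    Measurable fun h : History M K t => ∑ i, g (h i) :=
  Finset.measurable_sum _ fun i _ => hg.comp (measurable_pi_apply i)

lemma lintegral_historyLaw_add (v : EuclideanSpace ℝ (Fin d)) (n t : ℕ)
    {f : History M K t → ENNReal} (hf : Measurable f) :
    ∫⁻ h, f h ∂historyLaw arm p (θ + v) π n t =
      ∫⁻ h, f h * ENNReal.ofReal (Real.exp (∑ i, logRatio arm θ v (h i)))
        ∂historyLaw arm p θ π n t := by
  have hℓ := measurable_logRatio arm θ v
  induction t with
  | zero => simp [historyLaw]
  | succ t ih =>
    have hF : Measurable fun hr : History M K t × Round M K =>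
        f (Fin.snoc hr.1 hr.2 : History M K (t + 1)) := hf.comp (measurable_snoc t)
    have hs : ∀ s, Measurable fun h : History M K s =>
        ENNReal.ofReal (Real.exp (∑ i, logRatio arm θ v (h i))) := fun s =>
      (measurable_sum_round hℓ).exp.ennreal_ofReal
    have hfs : Measurable fun h : History M K (t + 1) =>
        f h * ENNReal.ofReal (Real.exp (∑ i, logRatio arm θ v (h i))) := hf.mul (hs _)
    rw [lintegral_historyLaw_succ _ _ _ _ _ _ hf,
      ih (Measurable.lintegral_kernel_prod_right' (κ := roundKernel arm p (θ + v) π n t) hF),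
      lintegral_historyLaw_succ _ _ _ _ _ _ hfs]
    refine lintegral_congr fun h => ?_
    have hfh : Measurable fun r : Round M K => f (Fin.snoc h r : History M K (t + 1)) :=
      hF.comp measurable_prodMk_left
    simp only [Fin.sum_univ_castSucc, Fin.snoc_castSucc, Fin.snoc_last, Real.exp_add]
    simp_rw [ENNReal.ofReal_mul (Real.exp_nonneg _), mul_left_comm (f _)]
    have hfr : Measurable fun r : Round M K => f (Fin.snoc h r : History M K (t + 1)) *
        ENNReal.ofReal (Real.exp (logRatio arm θ v r)) := hfh.mul hℓ.exp.ennreal_ofReal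
    rw [lintegral_const_mul _ hfr, mul_comm,
      lintegral_roundKernel _ _ _ _ _ _ _ hfh,
      lintegral_roundKernel _ _ _ _ _ _ _ hfr]
    congr 1
    refine lintegral_congr fun c => lintegral_congr fun k => ?_
    have hfy : Measurable fun y : ℝ => f (Fin.snoc h ((c, k), y) : History M K (t + 1)) :=
      hfh.comp measurable_prodMk_left
    rw [inner_add_right, lintegral_gaussianReal_add_mean _ _ hfy]
    rfl

/-- Change of measure: replacing `θ` by `θ + v` multiplies the law of the history by the
likelihood ratio. -/
lemma historyLaw_add (v : EuclideanSpace ℝ (Fin d)) (n t : ℕ) :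
    historyLaw arm p (θ + v) π n t = (historyLaw arm p θ π n t).withDensity
      fun h => ENNReal.ofReal (Real.exp (∑ i, logRatio arm θ v (h i))) := by
  have hs : Measurable fun h : History M K t =>
      ENNReal.ofReal (Real.exp (∑ i, logRatio arm θ v (h i))) :=
    (measurable_sum_round (measurable_logRatio arm θ v)).exp.ennreal_ofReal
  refine Measure.ext_of_lintegral _ fun f hf => ?_
  rw [lintegral_historyLaw_add _ _ _ _ _ _ _ hf, lintegral_withDensity_eq_lintegral_mul _ hs hf]
  exact lintegral_congr fun h => mul_comm _ _

/-- Given the context and arm of a round, its reward has the law `rewardKernel`. -/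
lemma exists_map_eval_historyLaw (n t : ℕ) (i : Fin t) :
    ∃ ν : Measure (Fin M × Fin K), IsProbabilityMeasure ν ∧
      (historyLaw arm p θ π n t).map (fun h => h i) = ν ⊗ₘ rewardKernel arm θ := by
  induction t with
  | zero => exact i.elim0
  | succ t ih =>
    induction i using Fin.lastCases with
    | cast i =>
      obtain ⟨ν, hν, h⟩ := ih i
      refine ⟨ν, hν, h ▸ Measure.ext_of_lintegral _ fun f hf => ?_⟩
      have hm : Measurable fun h : History M K (t + 1) => f (h i.castSucc) :=
        hf.comp (measurable_pi_apply _)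
      rw [lintegral_map hf (measurable_pi_apply i.castSucc),
        lintegral_map hf (measurable_pi_apply i), lintegral_historyLaw_succ _ _ _ _ _ _ hm]
      simp
    | last =>
      refine ⟨(historyLaw arm p θ π n t).bind
        ((Kernel.const (History M K t) p.toMeasure) ⊗ₖ (π.select n t)), inferInstance,
        Measure.ext_of_lintegral _ fun f hf => ?_⟩
      have hm : Measurable fun h : History M K (t + 1) => f (h (Fin.last t)) :=
        hf.comp (measurable_pi_apply _)
      have hk : Measurable fun a : Fin M × Fin K => ∫⁻ y, f (a, y) ∂rewardKernel arm θ a :=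
        measurable_of_finite _
      rw [lintegral_map hf (measurable_pi_apply (Fin.last t)),
        lintegral_historyLaw_succ _ _ _ _ _ _ hm,
        Measure.lintegral_compProd hf,
        Measure.lintegral_bind (Kernel.measurable _).aemeasurable hk.aemeasurable]
      refine lintegral_congr fun h => ?_
      rw [Kernel.lintegral_compProd _ _ _ hk]
      simp only [Fin.snoc_last]
      rw [lintegral_roundKernel _ _ _ _ _ _ _ hf]
      rfl

/-! ### Expected numbers of plays -/

/-- The expected number of times that the arm `a.2` is played in the context `a.1`. -/
def expectedPulls (n : ℕ) (a : Fin M × Fin K) : ℝ :=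
  ∫ h, (∑ t, if (h t).1 = a then (1 : ℝ) else 0) ∂historyLaw arm p θ π n n

lemma expectedPulls_nonneg (n : ℕ) (a : Fin M × Fin K) : 0 ≤ expectedPulls arm p θ π n a :=
  integral_nonneg fun h => Finset.sum_nonneg fun t _ => by positivity

lemma integrable_round {g : Round M K → ℝ} (hg : Measurable g)
    (hint : ∀ a : Fin M × Fin K,
      Integrable (fun y => g (a, y)) (gaussianReal ⟪arm a.1 a.2, θ⟫ 1))
    (n t : ℕ) (i : Fin t) : Integrable (fun h => g (h i)) (historyLaw arm p θ π n t) := by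
  obtain ⟨ν, hν, h⟩ := exists_map_eval_historyLaw arm p θ π n t i
  have : Integrable g ((historyLaw arm p θ π n t).map (fun h => h i)) := by
    rw [h, Measure.integrable_compProd_iff hg.aestronglyMeasurable]
    exact ⟨Eventually.of_forall hint, Integrable.of_finite⟩
  exact this.comp_measurable (measurable_pi_apply i)

lemma integral_round {g : Round M K → ℝ} (hg : Measurable g)
    (hint : ∀ a : Fin M × Fin K,
      Integrable (fun y => g (a, y)) (gaussianReal ⟪arm a.1 a.2, θ⟫ 1))
    (n t : ℕ) (i : Fin t) :
    ∫ h, g (h i) ∂historyLaw arm p θ π n t =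
      ∑ a : Fin M × Fin K, (∫ y, g (a, y) ∂gaussianReal ⟪arm a.1 a.2, θ⟫ 1) *
        ∫ h, (if (h i).1 = a then (1 : ℝ) else 0) ∂historyLaw arm p θ π n t := by
  obtain ⟨ν, hν, h⟩ := exists_map_eval_historyLaw arm p θ π n t i
  have key : ∀ f : Round M K → ℝ, Measurable f → (∀ a : Fin M × Fin K,
      Integrable (fun y => f (a, y)) (gaussianReal ⟪arm a.1 a.2, θ⟫ 1)) →
      ∫ h, f (h i) ∂historyLaw arm p θ π n t =
        ∑ a, ν.real {a} * ∫ y, f (a, y) ∂gaussianReal ⟪arm a.1 a.2, θ⟫ 1 := by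
    intro f hf hint
    have hi : Integrable f (ν ⊗ₘ rewardKernel arm θ) := by
      rw [Measure.integrable_compProd_iff hf.aestronglyMeasurable]
      exact ⟨Eventually.of_forall hint, Integrable.of_finite⟩
    rw [← integral_map (φ := fun h : History M K t => h i) (f := f)
        (measurable_pi_apply i).aemeasurable hf.aestronglyMeasurable, h,
      Measure.integral_compProd hi, integral_fintype Integrable.of_finite]
    rfl
  rw [key g hg hint]
  refine Finset.sum_congr rfl fun a _ => ?_
  rw [key (fun r => if r.1 = a then (1 : ℝ) else 0)
    (measurable_comp_arm fun b => if b = a then (1 : ℝ) else 0)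
    (fun b => integrable_const (if b = a then (1 : ℝ) else 0))]
  have : ∀ x : Fin M × Fin K,
      (∫ _, if x = a then (1 : ℝ) else 0 ∂gaussianReal ⟪arm x.1 x.2, θ⟫ 1) =
        if x = a then 1 else 0 := fun x => by simp
  simp [this, mul_comm]

lemma integrable_sum_round {g : Round M K → ℝ} (hg : Measurable g)
    (hint : ∀ a : Fin M × Fin K,
      Integrable (fun y => g (a, y)) (gaussianReal ⟪arm a.1 a.2, θ⟫ 1)) (n : ℕ) :
    Integrable (fun h => ∑ t, g (h t)) (historyLaw arm p θ π n n) :=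
  integrable_finsetSum _ fun i _ => integrable_round arm p θ π hg hint n n i

/-- Expectations of additive functionals of the history only depend on the expected numbers of
plays. -/
lemma integral_sum_round {g : Round M K → ℝ} (hg : Measurable g)
    (hint : ∀ a : Fin M × Fin K,
      Integrable (fun y => g (a, y)) (gaussianReal ⟪arm a.1 a.2, θ⟫ 1)) (n : ℕ) :
    ∫ h, ∑ t, g (h t) ∂historyLaw arm p θ π n n =
      ∑ a : Fin M × Fin K, (∫ y, g (a, y) ∂gaussianReal ⟪arm a.1 a.2, θ⟫ 1) *
        expectedPulls arm p θ π n a := by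
  rw [integral_finsetSum _ fun i _ => integrable_round arm p θ π hg hint n n i]
  simp_rw [integral_round arm p θ π hg hint, expectedPulls]
  rw [Finset.sum_comm]
  refine Finset.sum_congr rfl fun a _ => ?_
  rw [integral_finsetSum _ fun i _ => integrable_round arm p θ π
    (measurable_comp_arm fun b => if b = a then (1 : ℝ) else 0)
    (fun b => integrable_const (if b = a then (1 : ℝ) else 0)) n n i, Finset.mul_sum]

lemma integrable_id_gaussianReal_one (μ : ℝ) : Integrable (fun y : ℝ => y) (gaussianReal μ 1) :=
  memLp_one_iff_integrable.1 (memLp_id_gaussianReal (μ := μ) (v := 1) 1)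

lemma sum_expectedPulls (n : ℕ) : ∑ a, expectedPulls arm p θ π n a = n := by
  have h := integral_sum_round arm p θ π (g := fun _ => (1 : ℝ)) measurable_const
    (fun _ => integrable_const _) n
  simpa using h.symm

lemma expectedDesign_apply (n : ℕ) (i j : Fin d) :
    expectedDesign arm p θ π n i j =
      ∑ a : Fin M × Fin K, arm a.1 a.2 i * arm a.1 a.2 j * expectedPulls arm p θ π n a := by
  have h := integral_sum_round arm p θ π
    (g := fun r => arm r.1.1 r.1.2 i * arm r.1.1 r.1.2 j)
    (measurable_comp_arm fun a : Fin M × Fin K => arm a.1 a.2 i * arm a.1 a.2 j)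
    (fun a => integrable_const (arm a.1 a.2 i * arm a.1 a.2 j)) n
  simpa [expectedDesign, Matrix.sum_apply, Matrix.vecMulVec_apply, actionAt] using h

/-- The quadratic form `v ↦ vᵀ G v` of the expected design matrix `G`, written as a sum over the
arms weighted by their expected numbers of plays. -/
def designForm (n : ℕ) (v : EuclideanSpace ℝ (Fin d)) : ℝ :=
  ∑ a : Fin M × Fin K, expectedPulls arm p θ π n a * ⟪arm a.1 a.2, v⟫ ^ 2

lemma designForm_nonneg (n : ℕ) (v : EuclideanSpace ℝ (Fin d)) :
    0 ≤ designForm arm p θ π n v :=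
  Finset.sum_nonneg fun _ _ => mul_nonneg (expectedPulls_nonneg ..) (sq_nonneg _)

lemma designForm_smul (n : ℕ) (s : ℝ) (v : EuclideanSpace ℝ (Fin d)) :
    designForm arm p θ π n (s • v) = s ^ 2 * designForm arm p θ π n v := by
  simp only [designForm, inner_smul_right, mul_pow, Finset.mul_sum]
  exact Finset.sum_congr rfl fun a _ => by ring

lemma dotProduct_expectedDesign_mulVec (n : ℕ) (v : EuclideanSpace ℝ (Fin d)) :
    v.ofLp ⬝ᵥ (expectedDesign arm p θ π n *ᵥ v.ofLp) =
      designForm arm p θ π n v := by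
  simp only [designForm, dotProduct, Matrix.mulVec, expectedDesign_apply, PiLp.inner_apply, sq,
    Finset.sum_mul, Finset.mul_sum, RCLike.inner_apply, conj_trivial]
  rw [Finset.sum_congr rfl fun i _ => Finset.sum_comm, Finset.sum_comm]
  refine Finset.sum_congr rfl fun a _ => Finset.sum_congr rfl fun i _ =>
    Finset.sum_congr rfl fun j _ => ?_
  ring

lemma regret_eq_sum (n : ℕ) : regret arm p θ π n =
    ∑ a : Fin M × Fin K,
      ((⨆ k, ⟪arm a.1 k, θ⟫) - ⟪arm a.1 a.2, θ⟫) * expectedPulls arm p θ π n a := by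
  have h := integral_sum_round arm p θ π (g := fun r => (⨆ k, ⟪arm r.1.1 k, θ⟫) - r.2)
    ((measurable_comp_arm fun a : Fin M × Fin K => ⨆ k, ⟪arm a.1 k, θ⟫).sub measurable_snd)
    (fun a => (integrable_const (⨆ k, ⟪arm a.1 k, θ⟫)).sub (integrable_id_gaussianReal_one _)) n
  simp only [Finset.sum_sub_distrib] at h
  unfold regret
  refine h.trans (Finset.sum_congr rfl fun a _ => ?_)
  rw [integral_sub (integrable_const _) (integrable_id_gaussianReal_one _),
    integral_id_gaussianReal]
  simp

lemma inner_le_iSup (m : Fin M) (k : Fin K) : ⟪arm m k, θ⟫ ≤ ⨆ j, ⟪arm m j, θ⟫ :=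
  le_ciSup (f := fun j => ⟪arm m j, θ⟫) (Set.finite_range _).bddAbove k

/-- Plays of arms whose gap is at least `δ` cost at least `δ` each. -/
lemma mul_sum_expectedPulls_le_regret (n : ℕ) (m : Fin M) (S : Finset (Fin K)) {δ : ℝ}
    (hS : ∀ k ∈ S, ∃ j, ⟪arm m k, θ⟫ + δ ≤ ⟪arm m j, θ⟫) :
    δ * ∑ k ∈ S, expectedPulls arm p θ π n (m, k) ≤ regret arm p θ π n := by
  rw [regret_eq_sum, Fintype.sum_prod_type, Finset.mul_sum]
  have h0 : ∀ m k, 0 ≤ ((⨆ j, ⟪arm m j, θ⟫) - ⟪arm m k, θ⟫) *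
      expectedPulls arm p θ π n (m, k) := fun m k =>
    mul_nonneg (sub_nonneg.2 (inner_le_iSup arm θ m k)) (expectedPulls_nonneg ..)
  calc ∑ k ∈ S, δ * expectedPulls arm p θ π n (m, k)
      ≤ ∑ k ∈ S, ((⨆ j, ⟪arm m j, θ⟫) - ⟪arm m k, θ⟫) * expectedPulls arm p θ π n (m, k) := by
        refine Finset.sum_le_sum fun k hk =>
          mul_le_mul_of_nonneg_right ?_ (expectedPulls_nonneg ..)
        obtain ⟨j, hj⟩ := hS k hk
        linarith [inner_le_iSup arm θ m j]
    _ ≤ ∑ k, ((⨆ j, ⟪arm m j, θ⟫) - ⟪arm m k, θ⟫) * expectedPulls arm p θ π n (m, k) :=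
        Finset.sum_le_sum_of_subset_of_nonneg (Finset.subset_univ _) fun k _ _ => h0 m k
    _ ≤ _ := Finset.single_le_sum (f := fun m => ∑ k, ((⨆ j, ⟪arm m j, θ⟫) - ⟪arm m k, θ⟫) *
          expectedPulls arm p θ π n (m, k)) (fun m _ => Finset.sum_nonneg fun k _ => h0 m k)
          (Finset.mem_univ m)

/-! ### Likelihood ratio and relative entropy -/

variable (v : EuclideanSpace ℝ (Fin d))

lemma integrable_logRatio (a : Fin M × Fin K) :
    Integrable (fun y => logRatio arm θ v (a, y)) (gaussianReal ⟪arm a.1 a.2, θ⟫ 1) :=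
  (((integrable_id_gaussianReal_one _).sub (integrable_const ⟪arm a.1 a.2, θ⟫)).const_mul
    ⟪arm a.1 a.2, v⟫).sub (integrable_const (⟪arm a.1 a.2, v⟫ ^ 2 / 2))

/-- The relative entropy of the laws for `θ` and `θ + v` is half the design form at `v`. -/
lemma integral_sum_logRatio (n : ℕ) :
    ∫ h, ∑ t, logRatio arm θ v (h t) ∂historyLaw arm p θ π n n =
      -designForm arm p θ π n v / 2 := by
  rw [designForm, integral_sum_round arm p θ π (measurable_logRatio arm θ v)
    (integrable_logRatio arm θ v), neg_div, Finset.sum_div, ← Finset.sum_neg_distrib]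
  refine Finset.sum_congr rfl fun a _ => ?_
  have hi : Integrable (fun y => y - ⟪arm a.1 a.2, θ⟫) (gaussianReal ⟪arm a.1 a.2, θ⟫ 1) :=
    (integrable_id_gaussianReal_one _).sub (integrable_const _)
  simp only [logRatio]
  rw [integral_sub (hi.const_mul _) (integrable_const _), integral_const_mul,
    integral_sub (integrable_id_gaussianReal_one _) (integrable_const _),
    integral_id_gaussianReal]
  simp
  ring

lemma integrable_historyLaw_add_iff (n t : ℕ) (f : History M K t → ℝ) :
    Integrable f (historyLaw arm p (θ + v) π n t) ↔
      Integrable (fun h => Real.exp (∑ i, logRatio arm θ v (h i)) * f h)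
        (historyLaw arm p θ π n t) := by
  rw [historyLaw_add, integrable_withDensity_iff_integrable_smul'
    (measurable_sum_round (measurable_logRatio arm θ v)).exp.ennreal_ofReal (by simp)]
  simp [Real.exp_nonneg]

lemma integral_historyLaw_add (n t : ℕ) (f : History M K t → ℝ) :
    ∫ h, f h ∂historyLaw arm p (θ + v) π n t =
      ∫ h, Real.exp (∑ i, logRatio arm θ v (h i)) * f h ∂historyLaw arm p θ π n t := by
  rw [historyLaw_add, integral_withDensity_eq_integral_toReal_smul
    (measurable_sum_round (measurable_logRatio arm θ v)).exp.ennreal_ofReal (by simp)]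
  simp [Real.exp_nonneg]

end

/-! ### Counts of contexts and plays -/

/-- The number of rounds among the first `t` with context `m`. -/
def contextCount (m : Fin M) {t : ℕ} (h : History M K t) : ℝ :=
  ∑ i, if contextAt h i = m then 1 else 0

/-- The number of rounds among the first `t` in which the arm `a.2` is played in the
context `a.1`. -/
def pullCount (a : Fin M × Fin K) {t : ℕ} (h : History M K t) : ℝ :=
  ∑ i, if (h i).1 = a then 1 else 0

lemma pullCount_nonneg (a : Fin M × Fin K) {t : ℕ} (h : History M K t) : 0 ≤ pullCount a h :=
  Finset.sum_nonneg fun i _ => by positivity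

section

variable (arm : Fin M → Fin K → EuclideanSpace ℝ (Fin d)) (p : PMF (Fin M))
  (θ : EuclideanSpace ℝ (Fin d)) (π : Policy M K)

lemma integrable_pullCount (n : ℕ) (a : Fin M × Fin K) :
    Integrable (pullCount a) (historyLaw arm p θ π n n) :=
  integrable_sum_round arm p θ π
    (measurable_comp_arm fun b => if b = a then (1 : ℝ) else 0)
    (fun b => integrable_const (if b = a then (1 : ℝ) else 0)) n

lemma sum_pullCount (m : Fin M) {t : ℕ} (h : History M K t) :
    ∑ k, pullCount (m, k) h = contextCount m h := by
  simp only [pullCount, contextCount, contextAt]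
  rw [Finset.sum_comm]
  refine Finset.sum_congr rfl fun i _ => ?_
  by_cases hm : (h i).1.1 = m <;> simp [Prod.ext_iff, hm]

lemma measurable_contextCount (m : Fin M) (t : ℕ) :
    Measurable fun h : History M K t => contextCount m h :=
  measurable_sum_round
    (measurable_comp_arm fun a : Fin M × Fin K => if a.1 = m then (1 : ℝ) else 0)

lemma lintegral_exp_neg_contextCount (n : ℕ) (m : Fin M) :
    ∫⁻ h, ENNReal.ofReal (Real.exp (-(Real.log 2 * contextCount m h)))
      ∂historyLaw arm p θ π n n = ENNReal.ofReal ((1 - (p m).toReal / 2) ^ n) := by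
  have hq : (p m).toReal ≤ 1 :=
    ENNReal.toReal_le_of_le_ofReal one_pos.le (by simpa using p.coe_le_one m)
  have h1 : ∀ h : History M K n,
      ENNReal.ofReal (Real.exp (-(Real.log 2 * contextCount m h))) =
        ∏ i, ENNReal.ofReal (if contextAt h i = m then 1 / 2 else 1) := by
    intro h
    rw [← ENNReal.ofReal_prod_of_nonneg fun i _ => by positivity, contextCount, Finset.mul_sum,
      ← Finset.sum_neg_distrib, Real.exp_sum]
    congr 1
    refine Finset.prod_congr rfl fun i _ => ?_
    split_ifs <;> simp [Real.exp_neg, Real.exp_log]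
  simp_rw [h1]
  rw [lintegral_prod_contextAt arm p θ π n n
      (fun c => ENNReal.ofReal (if c = m then 1 / 2 else 1)),
    ← ofReal_integral_eq_lintegral_ofReal Integrable.of_finite
      (Eventually.of_forall fun c => by positivity),
    ENNReal.ofReal_pow (by linarith)]
  congr 2
  have h2 : ∀ c : Fin M, (if c = m then (1 / 2 : ℝ) else 1) = 1 - if c = m then 1 / 2 else 0 :=
    fun c => by split_ifs <;> norm_num
  simp_rw [h2]
  rw [integral_sub Integrable.of_finite Integrable.of_finite, integral_const,
    PMF.integral_eq_sum]
  simp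
  ring

lemma integrable_exp_neg_contextCount (n : ℕ) (m : Fin M) :
    Integrable (fun h => Real.exp (-(Real.log 2 * contextCount m h)))
      (historyLaw arm p θ π n n) := by
  refine ⟨((measurable_contextCount m n).const_mul _).neg.exp.aestronglyMeasurable, ?_⟩
  rw [hasFiniteIntegral_iff_ofReal (Eventually.of_forall fun _ => Real.exp_nonneg _),
    lintegral_exp_neg_contextCount]
  exact ENNReal.ofReal_lt_top

/-- A Chernoff bound: the integrand dominates the indicator of the event that context `m` occurs in
at most half of the expected number `p m * n` of rounds. The integral decays exponentially in `n`,
but the rate `8 / (p m * n)` suffices. -/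
lemma integral_exp_sub_contextCount_le {n : ℕ} (hn : 0 < n) {m : Fin M} (hm : 0 < p m) :
    ∫ h, Real.exp (Real.log 2 * ((p m).toReal * n / 2 - contextCount m h))
      ∂historyLaw arm p θ π n n ≤ 8 / ((p m).toReal * n) := by
  set q := (p m).toReal
  have hq0 : 0 < q := ENNReal.toReal_pos hm.ne' (p.apply_ne_top m)
  have hq : q ≤ 1 :=
    ENNReal.toReal_le_of_le_ofReal one_pos.le (by simpa using p.coe_le_one m)
  have hn' : (0 : ℝ) < n := Nat.cast_pos.2 hn
  have h1 : ∫ h, Real.exp (-(Real.log 2 * contextCount m h)) ∂historyLaw arm p θ π n n =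
      (1 - q / 2) ^ n := by
    rw [integral_eq_lintegral_of_nonneg_ae (Eventually.of_forall fun _ => Real.exp_nonneg _)
      (integrable_exp_neg_contextCount arm p θ π n m).1,
      lintegral_exp_neg_contextCount, ENNReal.toReal_ofReal (pow_nonneg (by linarith) _)]
  have h2 : ∀ h : History M K n, Real.exp (Real.log 2 * (q * n / 2 - contextCount m h)) =
      Real.exp (Real.log 2 * (q * n / 2)) * Real.exp (-(Real.log 2 * contextCount m h)) :=
    fun h => by rw [← Real.exp_add]; congr 1; ring
  simp_rw [h2]
  rw [integral_const_mul, h1]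
  have h3 : (1 - q / 2) ^ n ≤ Real.exp (-(q * n / 2)) := by
    calc (1 - q / 2) ^ n ≤ Real.exp (-(q / 2)) ^ n :=
          pow_le_pow_left₀ (by linarith) (Real.one_sub_le_exp_neg _) n
      _ = _ := by rw [← Real.exp_nat_mul]; congr 1; ring
  calc _ ≤ Real.exp (Real.log 2 * (q * n / 2)) * Real.exp (-(q * n / 2)) := by gcongr
    _ = Real.exp (-((1 - Real.log 2) * (q * n / 2))) := by rw [← Real.exp_add]; congr 1; ring
    _ ≤ Real.exp (-(q * n / 8)) := by
        rw [Real.exp_le_exp]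
        nlinarith [Real.log_two_lt_d9, mul_pos hq0 hn']
    _ ≤ (q * n / 8)⁻¹ := by
        rw [Real.exp_neg]
        exact inv_anti₀ (by positivity) (by linarith [Real.add_one_le_exp (q * n / 8)])
    _ = 8 / (q * n) := by rw [inv_div]

end

/-- A Bretagnolle–Huber type inequality. For a log-likelihood ratio `L` the left side is
`exp (-KL - 1)` and the integrand on the right is the minimum of the two densities. It follows
from Jensen's inequality for `min 0 L = L - L⁺` and `L⁺ ≤ exp L`. -/
lemma exp_integral_sub_one_le {Ω : Type*} [MeasurableSpace Ω] {μ : Measure Ω}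
    [IsProbabilityMeasure μ] {L : Ω → ℝ} (hL : Integrable L μ)
    (hexp : Integrable (fun x => Real.exp (L x)) μ) (h1 : ∫ x, Real.exp (L x) ∂μ ≤ 1) :
    Real.exp (∫ x, L x ∂μ - 1) ≤ ∫ x, Real.exp (min 0 (L x)) ∂μ := by
  have hmin : Integrable (fun x => min 0 (L x)) μ := (integrable_const 0).inf hL
  have hle : ∫ x, L x ∂μ - 1 ≤ ∫ x, min 0 (L x) ∂μ := by
    have : ∫ x, (L x - Real.exp (L x)) ∂μ ≤ ∫ x, min 0 (L x) ∂μ := by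
      refine integral_mono (hL.sub hexp) hmin fun x => ?_
      refine le_min ?_ ?_
      · linarith [Real.add_one_le_exp (L x)]
      · linarith [Real.exp_pos (L x)]
    rw [integral_sub hL hexp] at this
    linarith
  refine (Real.exp_le_exp.2 hle).trans ?_
  refine convexOn_exp.map_integral_le Real.continuous_exp.continuousOn isClosed_univ
    (by simp) hmin ?_
  refine (integrable_const (1 : ℝ)).mono' (Real.continuous_exp.comp_aestronglyMeasurable hmin.1)
    (Eventually.of_forall fun x => ?_)
  simp [abs_of_pos (Real.exp_pos _)]

/-! ### Lower bounds on the design form -/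

section

variable (arm : Fin M → Fin K → EuclideanSpace ℝ (Fin d)) (p : PMF (Fin M))
  (θ : EuclideanSpace ℝ (Fin d)) (π : Policy M K)

/-- The change-of-measure inequality. Either the arm `k₀` is played often in context `m`, which is
charged to the parameter `θ + v`, or rarely, and then under `θ` the other arms are played often in
context `m`, or the context `m` itself is rare. -/
lemma exp_neg_designForm_le (v : EuclideanSpace ℝ (Fin d)) {n : ℕ} (hn : 0 < n) {m : Fin M}
    (hm : 0 < p m) (k₀ : Fin K) :
    Real.exp (-designForm arm p θ π n v / 2 - 1) ≤
      4 / ((p m).toReal * n) * ∑ k ∈ Finset.univ.erase k₀, expectedPulls arm p θ π n (m, k) +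
      8 / ((p m).toReal * n) +
      4 / ((p m).toReal * n) * expectedPulls arm p (θ + v) π n (m, k₀) := by
  set q := (p m).toReal
  set P := historyLaw arm p θ π n n
  have hq0 : 0 < q := ENNReal.toReal_pos hm.ne' (p.apply_ne_top m)
  have hn' : (0 : ℝ) < n := Nat.cast_pos.2 hn
  have hqn : 0 < q * n := mul_pos hq0 hn'
  set L : History M K n → ℝ := fun h => ∑ t, logRatio arm θ v (h t)
  have hL : Integrable L P := integrable_sum_round arm p θ π (measurable_logRatio arm θ v)
    (integrable_logRatio arm θ v) n
  have hexp : Integrable (fun h => Real.exp (L h)) P := by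
    simpa using (integrable_historyLaw_add_iff arm p θ π v n n fun _ => (1 : ℝ)).1
      (integrable_const _)
  have hone : ∫ h, Real.exp (L h) ∂P ≤ 1 := by
    have := integral_historyLaw_add arm p θ π v n n fun _ => (1 : ℝ)
    simp only [integral_const, probReal_univ, smul_eq_mul, mul_one] at this
    exact this.ge
  have hpull : Integrable (fun h => Real.exp (L h) * pullCount (m, k₀) h) P :=
    (integrable_historyLaw_add_iff arm p θ π v n n _).1 (integrable_pullCount ..)
  have hsub : Integrable (fun h => ∑ k ∈ Finset.univ.erase k₀, pullCount (m, k) h) P :=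
    integrable_finsetSum _ fun k _ => integrable_pullCount ..
  have hctx : Integrable (fun h => Real.exp (Real.log 2 * (q * n / 2 - contextCount m h))) P := by
    refine ((integrable_exp_neg_contextCount arm p θ π n m).const_mul
      (Real.exp (Real.log 2 * (q * n / 2)))).congr (Eventually.of_forall fun h => ?_)
    simp only
    rw [← Real.exp_add]
    congr 1
    ring
  have hpt : ∀ h, Real.exp (min 0 (L h)) ≤
      4 / (q * n) * (∑ k ∈ Finset.univ.erase k₀, pullCount (m, k) h) +
        Real.exp (Real.log 2 * (q * n / 2 - contextCount m h)) +
        4 / (q * n) * (Real.exp (L h) * pullCount (m, k₀) h) := by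
    intro h
    have hN : pullCount (m, k₀) h + ∑ k ∈ Finset.univ.erase k₀, pullCount (m, k) h =
        contextCount m h := by
      rw [← sum_pullCount]
      exact Finset.add_sum_erase _ (fun k => pullCount (m, k) h) (Finset.mem_univ k₀)
    set A := ∑ k ∈ Finset.univ.erase k₀, pullCount (m, k) h
    set B := pullCount (m, k₀) h
    have hA : 0 ≤ A := Finset.sum_nonneg fun k _ => pullCount_nonneg _ _
    have hB : 0 ≤ B := pullCount_nonneg _ _
    have h4 : 0 < 4 / (q * n) := by positivity
    have hE := Real.exp_pos (L h)
    have hC := Real.exp_pos (Real.log 2 * (q * n / 2 - contextCount m h))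
    have h1 : Real.exp (min 0 (L h)) ≤ 1 := by simp
    have h2 : Real.exp (min 0 (L h)) ≤ Real.exp (L h) := by simp
    have hA' := mul_nonneg h4.le hA
    have hB' := mul_nonneg h4.le (mul_nonneg hE.le hB)
    have h1' : 4 / (q * n) * (q * n / 4) = 1 := by field_simp
    by_cases hb : q * n / 4 ≤ B
    · have := mul_le_mul_of_nonneg_left hb h4.le
      have : Real.exp (L h) * 1 ≤ Real.exp (L h) * (4 / (q * n) * B) := by
        gcongr; linarith
      linarith
    by_cases ha : q * n / 4 ≤ A
    · have := mul_le_mul_of_nonneg_left ha h4.le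
      linarith
    -- now the context `m` occurs less than `q * n / 2` times
    · have : 1 ≤ Real.exp (Real.log 2 * (q * n / 2 - contextCount m h)) :=
        Real.one_le_exp (mul_nonneg (Real.log_nonneg one_le_two) (by linarith))
      linarith
  calc Real.exp (-designForm arm p θ π n v / 2 - 1)
      = Real.exp (∫ h, L h ∂P - 1) := by rw [integral_sum_logRatio]
    _ ≤ ∫ h, Real.exp (min 0 (L h)) ∂P := exp_integral_sub_one_le hL hexp hone
    _ ≤ ∫ h, (4 / (q * n) * (∑ k ∈ Finset.univ.erase k₀, pullCount (m, k) h) +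
        Real.exp (Real.log 2 * (q * n / 2 - contextCount m h)) +
        4 / (q * n) * (Real.exp (L h) * pullCount (m, k₀) h)) ∂P :=
      integral_mono_of_nonneg (Eventually.of_forall fun _ => Real.exp_nonneg _)
        (((hsub.const_mul _).add hctx).add (hpull.const_mul _)) (Eventually.of_forall hpt)
    _ = 4 / (q * n) * ∑ k ∈ Finset.univ.erase k₀, expectedPulls arm p θ π n (m, k) +
        ∫ h, Real.exp (Real.log 2 * (q * n / 2 - contextCount m h)) ∂P +
        4 / (q * n) * expectedPulls arm p (θ + v) π n (m, k₀) := by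
      have hsum : Integrable (fun h => 4 / (q * n) * (∑ k ∈ Finset.univ.erase k₀,
          pullCount (m, k) h) + Real.exp (Real.log 2 * (q * n / 2 - contextCount m h))) P :=
        (hsub.const_mul _).add hctx
      rw [integral_add hsum (hpull.const_mul _),
        integral_add (hsub.const_mul _) hctx, integral_const_mul, integral_const_mul,
        integral_finsetSum _ fun k _ => integrable_pullCount arm p θ π n (m, k),
        ← integral_historyLaw_add]
      rfl
    _ ≤ _ := by
      gcongr
      exact integral_exp_sub_contextCount_le arm p θ π hn hm

variable {arm p θ π}

/-- Every direction that makes the optimal arm of some context suboptimal has to be explored at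
logarithmic rate. -/
lemma eventually_mul_log_le_designForm (hπ : IsConsistent arm π) (hp : ∀ m, 0 < p m)
    {m : Fin M} {k₀ : Fin K} (hopt : IsOptimalArm arm θ m k₀)
    (huniq : ∀ k, IsOptimalArm arm θ m k → k = k₀) {v : EuclideanSpace ℝ (Fin d)} {j : Fin K}
    (hj : ⟪arm m k₀, θ + v⟫ < ⟪arm m j, θ + v⟫) {c : ℝ} (hc : c < 2) :
    ∀ᶠ n : ℕ in atTop, c * Real.log n ≤ designForm arm p θ π n v := by
  have hq0 : 0 < (p m).toReal := ENNReal.toReal_pos (hp m).ne' (p.apply_ne_top m)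
  set q := (p m).toReal
  have hgap : ∀ k ∈ Finset.univ.erase k₀, 0 < ⟪arm m k₀, θ⟫ - ⟪arm m k, θ⟫ := by
    intro k hk
    refine sub_pos.2 (lt_of_not_ge fun hle => Finset.ne_of_mem_erase hk ?_)
    exact huniq k fun i => (hopt i).trans hle
  obtain ⟨δ, hδ0, hδ⟩ : ∃ δ > 0, ∀ k ∈ Finset.univ.erase k₀,
      δ ≤ ⟪arm m k₀, θ⟫ - ⟪arm m k, θ⟫ := by
    rcases (Finset.univ.erase k₀).eq_empty_or_nonempty with he | hne
    · exact ⟨1, one_pos, by simp [he]⟩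
    · obtain ⟨i, hi, hmin⟩ := Finset.exists_min_image _
        (fun k => ⟪arm m k₀, θ⟫ - ⟪arm m k, θ⟫) hne
      exact ⟨_, hgap i hi, hmin⟩
  obtain ⟨δ', hδ'0, hδ'⟩ : ∃ δ' > 0, ⟪arm m k₀, θ + v⟫ + δ' = ⟪arm m j, θ + v⟫ :=
    ⟨_, sub_pos.2 hj, by ring⟩
  -- the loss `2 * ε * log n` from the regret bounds leaves `2 * ε * log n` for the constants
  set ε := (2 - c) / 4
  have hε : 0 < ε := by simp only [ε]; linarith
  have hcε : c = 2 - 4 * ε := by simp only [ε]; ring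
  set C := (4 / δ + 8 + 4 / δ') / q
  have hC : 0 < C := by positivity
  have hlog : Tendsto (fun n : ℕ => Real.log n) atTop atTop :=
    Real.tendsto_log_atTop.comp tendsto_natCast_atTop_atTop
  filter_upwards [(hπ p hp θ ε hε).bound one_pos, (hπ p hp (θ + v) ε hε).bound one_pos,
    eventually_gt_atTop 0, hlog.eventually_ge_atTop ((2 + 2 * Real.log C) / (2 * ε))]
    with n hR hR' hn hlogn
  have hn' : (0 : ℝ) < n := Nat.cast_pos.2 hn
  have hn1 : (1 : ℝ) ≤ n := Nat.one_le_cast.2 hn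
  have hpow : 1 ≤ (n : ℝ) ^ ε := Real.one_le_rpow hn1 hε.le
  rw [one_mul, Real.norm_of_nonneg (zero_le_one.trans hpow)] at hR hR'
  have hA : ∑ k ∈ Finset.univ.erase k₀, expectedPulls arm p θ π n (m, k) ≤ (n : ℝ) ^ ε / δ := by
    rw [le_div_iff₀' hδ0]
    refine (mul_sum_expectedPulls_le_regret arm p θ π n m _ fun k hk => ⟨k₀, ?_⟩).trans
      ((Real.le_norm_self _).trans hR)
    linarith [hδ k hk]
  have hB : expectedPulls arm p (θ + v) π n (m, k₀) ≤ (n : ℝ) ^ ε / δ' := by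
    rw [le_div_iff₀' hδ'0]
    have := mul_sum_expectedPulls_le_regret arm p (θ + v) π n m {k₀} (δ := δ')
      fun k hk => ⟨j, by rw [Finset.mem_singleton.1 hk, hδ']⟩
    rw [Finset.sum_singleton] at this
    exact this.trans ((Real.le_norm_self _).trans hR')
  have hmain : Real.exp (-designForm arm p θ π n v / 2 - 1) ≤ C * (n : ℝ) ^ (ε - 1) := by
    refine (exp_neg_designForm_le arm p θ π v hn (hp m) k₀).trans ?_
    calc _ ≤ 4 / (q * n) * ((n : ℝ) ^ ε / δ) + 8 / (q * n) * (n : ℝ) ^ ε +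
          4 / (q * n) * ((n : ℝ) ^ ε / δ') := by
          gcongr
          exact le_mul_of_one_le_right (by positivity) hpow
      _ = C * (n : ℝ) ^ (ε - 1) := by
          rw [Real.rpow_sub_one hn'.ne']
          simp only [C]
          field_simp
  have := Real.log_le_log (Real.exp_pos _) hmain
  rw [Real.log_exp, Real.log_mul hC.ne' (by positivity), Real.log_rpow hn'] at this
  rw [div_le_iff₀ (by positivity)] at hlogn
  rw [hcε]
  linarith

/-- In a direction `v` on which all arms of each context agree, every play contributes, as the arms
span the space; in any other direction a multiple of `v` makes some optimal arm suboptimal. -/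
lemma eventually_designForm_pos (hπ : IsConsistent arm π) (hp : ∀ m, 0 < p m)
    (hspan : ∀ m, Submodule.span ℝ (Set.range (arm m)) = ⊤) {kstar : Fin M → Fin K}
    (hstar : ∀ m, IsOptimalArm arm θ m (kstar m))
    (huniq : ∀ m k, IsOptimalArm arm θ m k → k = kstar m)
    {v : EuclideanSpace ℝ (Fin d)} (hv : v ≠ 0) :
    ∀ᶠ n : ℕ in atTop, 0 < designForm arm p θ π n v := by
  by_cases h : ∃ m k, ⟪arm m k - arm m (kstar m), v⟫ ≠ 0
  · obtain ⟨m, k, hmk⟩ := h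
    set y := arm m k - arm m (kstar m)
    have hj : ⟪arm m (kstar m), θ + ((1 - ⟪y, θ⟫) / ⟪y, v⟫) • v⟫ <
        ⟪arm m k, θ + ((1 - ⟪y, θ⟫) / ⟪y, v⟫) • v⟫ := by
      rw [← sub_pos, ← inner_sub_left, inner_add_right, inner_smul_right, div_mul_cancel₀ _ hmk]
      simp [y]
    filter_upwards [eventually_mul_log_le_designForm hπ hp (hstar m) (huniq m) hj one_lt_two,
      eventually_gt_atTop 1] with n hn hn1
    rw [designForm_smul, one_mul] at hn
    exact pos_of_mul_pos_right ((Real.log_pos (Nat.one_lt_cast.2 hn1)).trans_le hn) (sq_nonneg _)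
  · push Not at h
    have hne : ∀ a : Fin M × Fin K, 0 < ⟪arm a.1 a.2, v⟫ ^ 2 := by
      refine fun a => sq_pos_of_ne_zero fun h0 => hv ?_
      have hk : ∀ k, ⟪arm a.1 k, v⟫ = 0 := fun k => by
        have h1 := h a.1 k
        have h2 := h a.1 a.2
        rw [inner_sub_left] at h1 h2
        linarith
      have hmem : v ∈ Submodule.span ℝ (Set.range (arm a.1)) := by simp [hspan]
      refine inner_self_eq_zero (𝕜 := ℝ).1 ?_
      refine Submodule.span_induction (p := fun x _ => ⟪x, v⟫ = 0) ?_ ?_ ?_ ?_ hmem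
      · rintro _ ⟨k, rfl⟩
        exact hk k
      · simp
      · intro x y _ _ hx hy
        rw [inner_add_left, hx, hy, add_zero]
      · intro s x _ hx
        rw [inner_smul_left, hx, mul_zero]
    filter_upwards [eventually_gt_atTop 0] with n hn
    have hsum : 0 < ∑ a, expectedPulls arm p θ π n a := by
      rw [sum_expectedPulls]; exact Nat.cast_pos.2 hn
    obtain ⟨a, -, ha⟩ := Finset.exists_lt_of_sum_lt (f := fun _ => (0 : ℝ)) (by simpa using hsum)
    exact Finset.sum_pos' (fun a _ => mul_nonneg (expectedPulls_nonneg ..) (sq_nonneg _))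
      ⟨a, Finset.mem_univ a, mul_pos ha (hne a)⟩

lemma eventually_isUnit_expectedDesign (hπ : IsConsistent arm π) (hp : ∀ m, 0 < p m)
    (hspan : ∀ m, Submodule.span ℝ (Set.range (arm m)) = ⊤) {kstar : Fin M → Fin K}
    (hstar : ∀ m, IsOptimalArm arm θ m (kstar m))
    (huniq : ∀ m k, IsOptimalArm arm θ m k → k = kstar m) :
    ∀ᶠ n : ℕ in atTop, IsUnit (expectedDesign arm p θ π n) := by
  -- there are finitely many possible sets of arms with positive weight, so that the set may be
  -- fixed before `n` is taken large
  have key : ∀ S : Finset (Fin M × Fin K), ∀ᶠ n : ℕ in atTop,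
      (∀ a, a ∈ S ↔ expectedPulls arm p θ π n a ≠ 0) →
        IsUnit (expectedDesign arm p θ π n) := by
    intro S
    by_cases h : ∃ v : EuclideanSpace ℝ (Fin d), v ≠ 0 ∧ ∀ a ∈ S, ⟪arm a.1 a.2, v⟫ = 0
    · obtain ⟨v, hv0, hv⟩ := h
      filter_upwards [eventually_designForm_pos hπ hp hspan hstar huniq hv0] with n hn hS
      refine absurd hn (Finset.sum_eq_zero fun a _ => ?_).not_gt
      by_cases ha : a ∈ S
      · simp [hv a ha]
      · simp [not_not.1 fun h' => ha ((hS a).2 h')]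
    · refine Eventually.of_forall fun n hS => ?_
      rw [Matrix.isUnit_iff_isUnit_det, isUnit_iff_ne_zero]
      intro hdet
      obtain ⟨u, hu0, hu⟩ := Matrix.exists_mulVec_eq_zero_iff.2 hdet
      refine h ⟨WithLp.toLp 2 u, by simpa using hu0, fun a ha => ?_⟩
      have h0 : designForm arm p θ π n (WithLp.toLp 2 u) = 0 := by
        rw [← dotProduct_expectedDesign_mulVec]
        simp [hu]
      have := (Finset.sum_eq_zero_iff_of_nonneg fun a _ =>
        mul_nonneg (expectedPulls_nonneg ..) (sq_nonneg _)).1 h0 a (Finset.mem_univ a)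
      simpa [(hS a).1 ha] using this
  classical
  filter_upwards [eventually_all.2 key] with n hn
  exact hn (Finset.univ.filter fun a => expectedPulls arm p θ π n a ≠ 0) (by simp)

/-! ### Duality -/

/-- The dual description `1 / ‖y‖²_{G⁻¹} = min {vᵀ G v | ⟪y, v⟫ = 1}`, at its minimiser. -/
lemma exists_designForm_eq_inv {n : ℕ} (hG : IsUnit (expectedDesign arm p θ π n))
    {y : EuclideanSpace ℝ (Fin d)} (hy : 0 < weightedNorm (expectedDesign arm p θ π n)⁻¹ y ^ 2) :
    ∃ v, ⟪y, v⟫ = 1 ∧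
      designForm arm p θ π n v = (weightedNorm (expectedDesign arm p θ π n)⁻¹ y ^ 2)⁻¹ := by
  set G := expectedDesign arm p θ π n
  set u : EuclideanSpace ℝ (Fin d) := WithLp.toLp 2 (G⁻¹ *ᵥ y.ofLp)
  have hGu : G *ᵥ u.ofLp = y.ofLp := by
    simp only [u]
    rw [Matrix.mulVec_mulVec, Matrix.mul_nonsing_inv _ ((Matrix.isUnit_iff_isUnit_det _).1 hG),
      Matrix.one_mulVec]
  have hQ : designForm arm p θ π n u = y.ofLp ⬝ᵥ (G⁻¹ *ᵥ y.ofLp) := by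
    rw [← dotProduct_expectedDesign_mulVec, hGu, dotProduct_comm]
  have hnorm : weightedNorm G⁻¹ y ^ 2 = designForm arm p θ π n u := by
    rw [weightedNorm, ← hQ, Real.sq_sqrt (designForm_nonneg ..)]
  rw [hnorm] at hy ⊢
  refine ⟨(designForm arm p θ π n u)⁻¹ • u, ?_, ?_⟩
  · have : ⟪y, u⟫ = designForm arm p θ π n u := by
      rw [hQ, EuclideanSpace.inner_eq_star_dotProduct, dotProduct_comm]
      simp [u]
    rw [inner_smul_right, this, inv_mul_cancel₀ hy.ne']
  · rw [designForm_smul]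
    field_simp

end

end ContextualBandit

end

theorem lemma1 {d M K : ℕ}
    (arm : Fin M → Fin K → EuclideanSpace ℝ (Fin d))
    (harm_inj : ∀ m, Function.Injective (arm m))
    (harm_span : ∀ m, Submodule.span ℝ (Set.range (arm m)) = ⊤)
    (harm_norm : ∀ m k, ‖arm m k‖ ≤ 1)
    (p : PMF (Fin M)) (hp : ∀ m, 0 < p m)
    (θ : EuclideanSpace ℝ (Fin d))
    (kstar : Fin M → Fin K)
    (hstar : ∀ m, ContextualBandit.IsOptimalArm arm θ m (kstar m))
    (hstar_unique : ∀ m k, ContextualBandit.IsOptimalArm arm θ m k → k = kstar m)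
    (π : ContextualBandit.Policy M K)
    (hπ : ContextualBandit.IsConsistent arm π) :
    (∀ᶠ n : ℕ in atTop, IsUnit (ContextualBandit.expectedDesign arm p θ π n)) ∧
    ∀ (m : Fin M) (k : Fin K),
      limsup (fun n : ℕ =>
        ((Real.log n * ContextualBandit.weightedNorm
          (ContextualBandit.expectedDesign arm p θ π n)⁻¹
          (arm m k - arm m (kstar m)) ^ 2 : ℝ) : EReal)) atTop
      ≤ ((⟪arm m (kstar m) - arm m k, θ⟫ ^ 2 / 2 : ℝ) : EReal) := by
  have hunit := ContextualBandit.eventually_isUnit_expectedDesign (θ := θ) hπ hp harm_span hstar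
    hstar_unique
  refine ⟨hunit, fun m k => le_of_not_gt fun hlt => ?_⟩
  obtain ⟨c, hcΔ, hc⟩ := EReal.lt_iff_exists_real_btwn.1 hlt
  have hfreq := frequently_lt_of_lt_limsup (by isBoundedDefault) hc
  simp only [EReal.coe_lt_coe_iff] at hcΔ hfreq
  set y := arm m k - arm m (kstar m) with hy
  set Δ := ⟪arm m (kstar m) - arm m k, θ⟫ with hΔ
  have hyθ : ⟪y, θ⟫ = -Δ := by rw [hy, hΔ, ← inner_neg_left, neg_sub]
  have hΔ0 : 0 ≤ Δ := by
    rw [hΔ, inner_sub_left]; exact sub_nonneg.2 (hstar m k)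
  have hc0 : 0 < c := lt_of_le_of_lt (by positivity) hcΔ
  -- room for the loss in the compactness step
  obtain ⟨b, hcb, hbΔ⟩ : ∃ b, 1 / c < b ∧ b * Δ ^ 2 < 2 := by
    have : Tendsto (fun b => b * Δ ^ 2) (𝓝[>] (1 / c)) (𝓝 (1 / c * Δ ^ 2)) :=
      (Continuous.tendsto (by fun_prop) _).mono_left nhdsWithin_le_nhds
    have h2 : 1 / c * Δ ^ 2 < 2 := by
      rw [one_div_mul_eq_div, div_lt_iff₀ hc0]; linarith
    exact (eventually_mem_nhdsWithin.and (this.eventually (gt_mem_nhds h2))).exists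
  -- the minimisers of the design form on `⟪y, v⟫ = 1`, normalised by `log n`, give a fixed `v`
  obtain ⟨v, hyv, hv⟩ := exists_frequently_sum_sq_le
    (fun a : Fin M × Fin K => arm a.1 a.2) y
    (fun n a => ContextualBandit.expectedPulls arm p θ π n a / Real.log n)
    (fun n a => div_nonneg (ContextualBandit.expectedPulls_nonneg ..)
      (Real.log_natCast_nonneg n)) hcb (by
      refine (hfreq.and_eventually (hunit.and (eventually_gt_atTop 1))).mono ?_
      rintro n ⟨hn, hG, hn1⟩
      have hlog : 0 < Real.log n := Real.log_pos (Nat.one_lt_cast.2 hn1)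
      have hpos := pos_of_mul_pos_right (hc0.trans hn) hlog.le
      obtain ⟨v, hyv, hv⟩ := ContextualBandit.exists_designForm_eq_inv hG hpos
      refine ⟨v, hyv, ?_⟩
      simp_rw [div_mul_eq_mul_div]
      rw [← Finset.sum_div]
      change ContextualBandit.designForm arm p θ π n v / _ ≤ _
      rw [hv, ← one_div, div_div, mul_comm]
      exact one_div_le_one_div_of_le hc0 hn.le)
  -- `t > Δ` makes the arm `k` better than `kstar m` for the parameter `θ + t • v`
  obtain ⟨t, htΔ, htb⟩ : ∃ t, Δ < t ∧ b * t ^ 2 < 2 := by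
    have : Tendsto (fun t => b * t ^ 2) (𝓝[>] Δ) (𝓝 (b * Δ ^ 2)) :=
      (Continuous.tendsto (by fun_prop) _).mono_left nhdsWithin_le_nhds
    exact (eventually_mem_nhdsWithin.and (this.eventually (gt_mem_nhds hbΔ))).exists
  obtain ⟨c', hc'b, hc'2⟩ := exists_between htb
  have hj : ⟪arm m (kstar m), θ + t • v⟫ < ⟪arm m k, θ + t • v⟫ := by
    rw [← sub_pos, ← inner_sub_left, ← hy, inner_add_right, inner_smul_right, hyv, hyθ]
    linarith
  have hlower := ContextualBandit.eventually_mul_log_le_designForm hπ hp (hstar m)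
    (hstar_unique m) hj hc'2
  obtain ⟨n, hn, hn', hn1⟩ := (hv.and_eventually (hlower.and (eventually_gt_atTop 1))).exists
  have hlog : 0 < Real.log n := Real.log_pos (Nat.one_lt_cast.2 hn1)
  simp_rw [div_mul_eq_mul_div] at hn
  rw [← Finset.sum_div, div_le_iff₀ hlog] at hn
  change ContextualBandit.designForm arm p θ π n v ≤ _ at hn
  rw [ContextualBandit.designForm_smul] at hn'
  have h1 := mul_le_mul_of_nonneg_left hn (sq_nonneg t)
  have h2 := mul_lt_mul_of_pos_right hc'b hlog
  linarith
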